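/- **Theorem 3.3.** Let $\mathcal X,\mathcal Y,\mathcal Z,\widetilde{\mathcal Z},\mathfrak Z$ be finite-dimensional real Hilbert spaces, and let $\Gamma_0(\mathcal H)$ denote the set of proper lower semicontinuous convex functions $\varphi:\mathcal H\to(-\infty,\infty]$, with $\operatorname{dom}\varphi=\{x\mid\varphi(x)<\infty\}$. For $\varphi\in\Gamma_0(\mathcal H)$ put $\operatorname{rec}(\varphi)(x)=\sup_{v\in\operatorname{dom}\varphi}(\varphi(v+x)-\varphi(v))$, and call $\varphi$ *coercive* if $\operatorname{rec}(\varphi)(x)>0$ for all $x\neq 0$. Let $A:\mathcal X\to\mathcal Y$, $\mathfrak L:\mathcal X\to\mathcal Z$, $B:\mathcal Z\to\widetilde{\mathcal Z}$, $\mathfrak C:\mathcal X\to\mathfrak Z$ be linear, $\mu>0$, $f\in\Gamma_0(\mathcal Y)$ with $\operatorname{dom} f=\mathcal Y$ (differentiability of $f$ is not required), $\Psi\in\Gamma_0(\mathcal Z)$ coercive, and $\Delta\subset\mathfrak Z$ closed and convex, with $\operatorname{dom}(\Psi\circ\mathfrak L)\cap\mathfrak C^{-1}(\Delta)\neq\emptyset$,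 where $\mathfrak C^{-1}(\Delta)=\{x\in\mathcal X\mid\mathfrak Cx\in\Delta\}$. Define $$\Psi_B(z)=\Psi(z)-\min_{v\in\mathcal Z}\Big[\Psi(v)+\tfrac12\|B(z-v)\|^2\Big],\qquad J(x)=f(Ax)+\mu\,\Psi_B(\mathfrak Lx).$$ Assume the overall convexity condition $(C_1)$: $f\circ A$ is $\mu$-strongly convex relative to $x\mapsto\frac12\langle\mathfrak L^*B^*B\mathfrak Lx,x\rangle$, that is, the function $x\mapsto f(Ax)-\frac{\mu}{2}\|B\mathfrak Lx\|^2$ is convex on $\mathcal X$. Call a set *asymptotically multipolyhedral* if it equals $S+K$ for some compact set $S$ and some polyhedral cone $K$; here a cone is a set $K$ with $\alpha x\in K$ for all $x\in K$ and $\alpha>0$, and a polyhedral set is a finite intersection of closed half-spaces. Then the problem $\min_{\mathfrak Cx\in\Delta}J(x)$ has a minimizer, i.e. there is $x^\star\in\mathfrak C^{-1}(\Delta)$ with $J(x^\star)\le J(x)$ for all $x\in\mathfrak C^{-1}(\Delta)$, if any one of the following holds: (i) $f$ is coercive and $\mathfrak C^{-1}(\Delta)$ is asymptotically multipolyhedral;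 (ii) $f$ is coercive and $\operatorname{null}A\cap\operatorname{null}\mathfrak L=\{0\}$; (iii) $f$ is bounded below and $\operatorname{null}\mathfrak L=\{0\}$; (iv) $\mathfrak C^{-1}(\Delta)$ is bounded. -/

import Mathlib

open scoped Pointwise

namespace CLiGME

noncomputable section

/-- The effective domain `dom φ = {x | φ x < ∞}`. -/
def dom {H : Type*} (φ : H → EReal) : Set H :=
  {x | φ x < ⊤}

/-- Convexity of an extended-real-valued function. It is used for functions with values in
`(-∞, ∞]`, for which the right-hand side below is a sum of two real numbers. -/
def IsConvex {H : Type*} [AddCommGroup H] [Module ℝ H] (φ : H → EReal) : Prop :=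
  ∀ x ∈ dom φ, ∀ y ∈ dom φ, ∀ t : ℝ, 0 < t → t < 1 →
    φ (t • x + (1 - t) • y) ≤ (t : EReal) * φ x + ((1 - t : ℝ) : EReal) * φ y

/-- The class `Γ₀(H)`: functions `H → (-∞, ∞]` that are proper, lower semicontinuous and convex. -/
structure IsGammaZero {H : Type*} [NormedAddCommGroup H] [InnerProductSpace ℝ H]
    (φ : H → EReal) : Prop where
  ne_bot : ∀ x, φ x ≠ ⊥
  proper : (dom φ).Nonempty
  lsc : LowerSemicontinuous φ
  convex : IsConvex φ

/-- The recession function `rec φ (x) = sup_{v ∈ dom φ} (φ (v + x) - φ v)`. -/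
def recession {H : Type*} [AddCommGroup H] (φ : H → EReal) (x : H) : EReal :=
  ⨆ v ∈ dom φ, (φ (v + x) - φ v)

/-- Coercivity: the recession function is positive away from the origin. -/
def IsCoercive {H : Type*} [AddCommGroup H] (φ : H → EReal) : Prop :=
  ∀ x : H, x ≠ 0 → 0 < recession φ x

/-- Boundedness below by a real constant. -/
def IsBoundedBelow {H : Type*} (φ : H → EReal) : Prop :=
  ∃ m : ℝ, ∀ x, (m : EReal) ≤ φ x

/-- The quadratic function `q_M x = (1/2) ⟪M x, x⟫`. -/
def quad {H : Type*} [NormedAddCommGroup H] [InnerProductSpace ℝ H]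
    (M : H →ₗ[ℝ] H) (x : H) : ℝ :=
  (1 / 2) * inner ℝ (M x) x

/-- `φ` is `α`-strongly convex relative to `q_M`: the function `φ - α q_M` is convex. -/
def IsStronglyConvexRel {H : Type*} [NormedAddCommGroup H] [InnerProductSpace ℝ H]
    (α : ℝ) (M : H →ₗ[ℝ] H) (φ : H → EReal) : Prop :=
  IsConvex fun x => φ x - ((α * quad M x : ℝ) : EReal)

/-- The generalized Moreau enhanced function
`Ψ_B z = Ψ z - min_v [Ψ v + (1/2) ‖B (z - v)‖²]`. The minimum is written as the infimum in the
extended reals, which equals it whenever it is attained. -/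
def gme {Z W : Type*} [NormedAddCommGroup Z] [InnerProductSpace ℝ Z]
    [NormedAddCommGroup W] [InnerProductSpace ℝ W]
    (Ψ : Z → EReal) (B : Z →ₗ[ℝ] W) (z : Z) : EReal :=
  Ψ z - ⨅ v : Z, (Ψ v + (((1 / 2) * ‖B (z - v)‖ ^ 2 : ℝ) : EReal))

/-- The cost function `J = f ∘ A + μ Ψ_B ∘ L`. -/
def cost {X Y Z W : Type*} [NormedAddCommGroup X] [InnerProductSpace ℝ X]
    [NormedAddCommGroup Y] [InnerProductSpace ℝ Y]
    [NormedAddCommGroup Z] [InnerProductSpace ℝ Z]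
    [NormedAddCommGroup W] [InnerProductSpace ℝ W]
    (f : Y → EReal) (A : X →ₗ[ℝ] Y) (μ : ℝ) (Ψ : Z → EReal) (B : Z →ₗ[ℝ] W) (L : X →ₗ[ℝ] Z)
    (x : X) : EReal :=
  f (A x) + (μ : EReal) * gme Ψ B (L x)

/-- The overall convexity condition: `f ∘ A` is `μ`-strongly convex relative to `q_{L* B* B L}`. -/
def OverallConvexity {X Y Z W : Type*}
    [NormedAddCommGroup X] [InnerProductSpace ℝ X] [FiniteDimensional ℝ X]
    [NormedAddCommGroup Y] [InnerProductSpace ℝ Y]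
    [NormedAddCommGroup Z] [InnerProductSpace ℝ Z] [FiniteDimensional ℝ Z]
    [NormedAddCommGroup W] [InnerProductSpace ℝ W] [FiniteDimensional ℝ W]
    (f : Y → EReal) (A : X →ₗ[ℝ] Y) (μ : ℝ) (B : Z →ₗ[ℝ] W) (L : X →ₗ[ℝ] Z) : Prop :=
  IsStronglyConvexRel μ
    (LinearMap.adjoint L ∘ₗ LinearMap.adjoint B ∘ₗ B ∘ₗ L) (fun x => f (A x))

/-- A polyhedral set: a finite intersection of closed half-spaces. -/
def IsPolyhedral {H : Type*} [NormedAddCommGroup H] [InnerProductSpace ℝ H]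
    (K : Set H) : Prop :=
  ∃ (n : ℕ) (a : Fin n → H) (b : Fin n → ℝ),
    (∀ i, a i ≠ 0) ∧ K = {x | ∀ i, inner ℝ (a i) x ≤ b i}

/-- A cone: a set stable under multiplication by positive scalars. -/
def IsCone {H : Type*} [AddCommGroup H] [Module ℝ H] (K : Set H) : Prop :=
  ∀ x ∈ K, ∀ t : ℝ, 0 < t → t • x ∈ K

/-- An asymptotically multipolyhedral set: the Minkowski sum of a compact set and a
polyhedral cone. -/
def IsAsymptoticallyMultipolyhedral {H : Type*} [NormedAddCommGroup H] [InnerProductSpace ℝ H]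
    (C : Set H) : Prop :=
  ∃ S K : Set H, IsCompact S ∧ IsPolyhedral K ∧ IsCone K ∧ C = S + K

end

end CLiGME

/-!
`Ψ_B z` is the supremum over `v ∈ dom Ψ` of `Ψ z - Ψ v - ‖B (z - v)‖² / 2`. Expanding the squares
in `J` moves `-μ / 2 * ‖B L x‖²` next to `f (A x)`, where `C₁` makes the sum convex, so `J` is a
supremum of closed convex functions and is itself closed and convex.

Suppose that `J` is bounded above on a ray `x + t d` and that `f ∘ A` is bounded below. As
`f ∘ A ≤ J`, relative strong convexity of `f ∘ A` forces `B L d = 0`; then `Ψ ∘ L` is bounded above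
on the ray as well, and coercivity of `Ψ` gives `L d = 0`. If `f` is coercive, also `A d = 0`. So
`J` has compact sublevel sets modulo `N = ker A ∩ ker L`, along which it is constant, and one
minimises over the slice `(D + N) ∩ Nᗮ` of the constraint set `D`. If `D` is asymptotically
multipolyhedral, `D + N` is closed because projections of polyhedra are polyhedra.
-/

namespace CLiGME

open Filter Topology

section Polyhedron

variable {k E ι : Type*} [Field k] [LinearOrder k] [IsStrictOrderedRing k]
  [AddCommGroup E] [Module k E]

/-- A polyhedron in a vector space over an ordered field: the solution set of finitely many weak
linear inequalities. Unlike in `IsPolyhedral`, the functionals may vanish, so that the class is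
stable under elimination of variables. -/
def IsPolyhedron (k : Type*) {E : Type*} [Field k] [LinearOrder k] [AddCommGroup E] [Module k E]
    (K : Set E) : Prop :=
  ∃ (ι : Type) (_ : Finite ι) (g : ι → Module.Dual k E) (b : ι → k), K = {x | ∀ i, g i x ≤ b i}

/-- Fourier–Motzkin elimination of the variable `t`. -/
theorem exists_forall_mul_le_iff [Finite ι] (a c : ι → k) :
    (∃ t, ∀ i, a i * t ≤ c i) ↔
      (∀ i, a i = 0 → 0 ≤ c i) ∧ ∀ i j, 0 < a i → a j < 0 → a j * c i ≤ a i * c j := by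
  constructor
  · rintro ⟨t, ht⟩
    refine ⟨fun i hi => by simpa [hi] using ht i, fun i j hi hj => ?_⟩
    calc a j * c i ≤ a j * (a i * t) := mul_le_mul_of_nonpos_left (ht i) hj.le
      _ = a i * (a j * t) := by ring
      _ ≤ a i * c j := mul_le_mul_of_nonneg_left (ht j) hi.le
  · rintro ⟨hzero, hpair⟩
    suffices ∃ t, (∀ i, 0 < a i → t ≤ c i / a i) ∧ ∀ j, a j < 0 → c j / a j ≤ t by
      obtain ⟨t, hpos, hneg⟩ := this
      refine ⟨t, fun i => ?_⟩
      rcases lt_trichotomy (a i) 0 with hi | hi | hi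
      · exact (div_le_iff_of_neg' hi).1 (hneg i hi)
      · simpa [hi] using hzero i hi
      · exact (le_div_iff₀' hi).1 (hpos i hi)
    rcases isEmpty_or_nonempty {j // a j < 0} with hN | hN
    · obtain ⟨t, ht⟩ := Finite.exists_ge fun i => c i / a i
      exact ⟨t, fun i _ => ht i, fun j hj => hN.elim ⟨j, hj⟩⟩
    · obtain ⟨⟨j, hj⟩, hmax⟩ := Finite.exists_max fun j : {j // a j < 0} => c j / a j
      refine ⟨c j / a j, fun i hi => ?_, fun j' hj' => hmax ⟨j', hj'⟩⟩
      rw [div_le_iff_of_neg hj, div_mul_eq_mul_div, div_le_iff₀ hi]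
      linarith [hpair i j hi hj]

open Submodule in
theorem IsPolyhedron.add_span_singleton {K : Set E} (hK : IsPolyhedron k K) (v : E) :
    IsPolyhedron k (K + (k ∙ v : Set E)) := by
  obtain ⟨ι, _, g, b, rfl⟩ := hK
  have mem_iff (x : E) : x ∈ {x | ∀ i, g i x ≤ b i} + (k ∙ v : Set E) ↔
      ∃ t : k, ∀ i, g i v * t ≤ b i - g i x := by
    simp only [Set.mem_add, SetLike.mem_coe, mem_span_singleton]
    constructor
    · rintro ⟨y, hy, _, ⟨t, rfl⟩, rfl⟩
      exact ⟨-t, fun i => by simpa [mul_comm] using hy i⟩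
    · rintro ⟨t, ht⟩
      refine ⟨x + t • v, fun i => ?_, -t • v, ⟨-t, rfl⟩, by simp⟩
      simpa [mul_comm, le_sub_iff_add_le'] using ht i
  refine ⟨{i // g i v = 0} ⊕ {p : ι × ι // 0 < g p.1 v ∧ g p.2 v < 0}, inferInstance,
    Sum.elim (fun i => g i) fun p => g p.1.1 v • g p.1.2 - g p.1.2 v • g p.1.1,
    Sum.elim (fun i => b i) fun p => g p.1.1 v * b p.1.2 - g p.1.2 v * b p.1.1, ?_⟩
  ext x
  rw [mem_iff, exists_forall_mul_le_iff]
  simp only [Set.mem_ofPred_eq, Sum.forall, Sum.elim_inl, Sum.elim_inr, Subtype.forall,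
    Prod.forall, LinearMap.sub_apply, LinearMap.smul_apply, smul_eq_mul, sub_nonneg, and_imp]
  refine and_congr_right fun _ => forall₄_congr fun i j _ _ => ?_
  constructor <;> intro h <;> linarith

theorem IsPolyhedron.add_submodule {K : Set E} (hK : IsPolyhedron k K) {N : Submodule k E}
    (hN : N.FG) : IsPolyhedron k (K + (N : Set E)) := by
  induction N, hN using Submodule.fg_induction generalizing K with
  | singleton v => exact hK.add_span_singleton v
  | sup N₁ N₂ _ _ h₁ h₂ =>
    rw [Submodule.coe_sup, ← add_assoc]
    exact h₂ (h₁ hK)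

theorem IsPolyhedron.isClosed {E : Type*} [AddCommGroup E] [Module ℝ E] [TopologicalSpace E]
    [IsTopologicalAddGroup E] [ContinuousSMul ℝ E] [T2Space E] [FiniteDimensional ℝ E]
    {K : Set E} (hK : IsPolyhedron ℝ K) : IsClosed K := by
  obtain ⟨ι, _, g, b, rfl⟩ := hK
  rw [Set.ofPred_forall]
  exact isClosed_iInter fun i =>
    isClosed_le (g i).continuous_of_finiteDimensional continuous_const

variable {H : Type*} [NormedAddCommGroup H] [InnerProductSpace ℝ H]

theorem IsPolyhedral.isPolyhedron {K : Set H} (hK : IsPolyhedral K) : IsPolyhedron ℝ K := by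
  obtain ⟨n, a, b, -, rfl⟩ := hK
  exact ⟨Fin n, inferInstance, fun i => innerₗ H (a i), b, rfl⟩

theorem IsAsymptoticallyMultipolyhedral.isClosed_add_submodule [FiniteDimensional ℝ H]
    {D : Set H} (hD : IsAsymptoticallyMultipolyhedral D) (N : Submodule ℝ H) :
    IsClosed (D + (N : Set H)) := by
  obtain ⟨S, K, hS, hK, -, rfl⟩ := hD
  rw [add_assoc]
  exact (hK.isPolyhedron.add_submodule (IsNoetherian.noetherian N)).isClosed.add_left_of_isCompact
    hS

end Polyhedron

section ClosedConvex

variable {H : Type*} [AddCommGroup H] [Module ℝ H] {φ ψ : H → EReal}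

theorem IsConvex.convex_epigraph (hφ : IsConvex φ) : Convex ℝ {p : H × ℝ | φ p.1 ≤ p.2} := by
  refine convex_iff_forall_pos.2 fun p hp q hq a b ha hb hab => ?_
  obtain rfl : b = 1 - a := by linarith
  calc φ (a • p.1 + (1 - a) • q.1) ≤ a * φ p.1 + ((1 - a : ℝ) : EReal) * φ q.1 :=
        hφ _ (hp.trans_lt (EReal.coe_lt_top _)) _ (hq.trans_lt (EReal.coe_lt_top _)) a ha
          (by linarith)
    _ ≤ a * p.2 + ((1 - a : ℝ) : EReal) * q.2 :=
        add_le_add (mul_le_mul_of_nonneg_left hp (by exact_mod_cast ha.le))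
          (mul_le_mul_of_nonneg_left hq (by exact_mod_cast hb.le))

theorem IsConvex.convex_sublevel (hφ : IsConvex φ) (c : ℝ) : Convex ℝ {x | φ x ≤ c} := by
  intro x hx y hy a b ha hb hab
  have := hφ.convex_epigraph (x := (x, c)) hx (y := (y, c)) hy ha hb hab
  simpa [← add_smul, ← add_mul, hab] using this

theorem IsConvex.add (hφ : IsConvex φ) (hψ : IsConvex ψ) (hφ_bot : ∀ x, φ x ≠ ⊥)
    (hψ_bot : ∀ x, ψ x ≠ ⊥) : IsConvex fun x => φ x + ψ x := by
  have mem_dom {x : H} (hx : φ x + ψ x < ⊤) : x ∈ dom φ ∧ x ∈ dom ψ :=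
    ⟨lt_top_iff_ne_top.2 fun h => hx.ne (h ▸ EReal.top_add_of_ne_bot (hψ_bot x)),
      lt_top_iff_ne_top.2 fun h => hx.ne (h ▸ EReal.add_top_of_ne_bot (hφ_bot x))⟩
  have mul_add {s : ℝ} (hs : 0 ≤ s) (u v : EReal) : (s : EReal) * (u + v) = s * u + s * v :=
    EReal.left_distrib_of_nonneg_of_ne_top (by exact_mod_cast hs) (EReal.coe_ne_top s) u v
  intro x hx y hy t ht₀ ht₁
  refine (add_le_add (hφ x (mem_dom hx).1 y (mem_dom hy).1 t ht₀ ht₁)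
    (hψ x (mem_dom hx).2 y (mem_dom hy).2 t ht₀ ht₁)).trans_eq ?_
  rw [mul_add ht₀.le, mul_add (sub_nonneg.2 ht₁.le), add_add_add_comm]

theorem IsConvex.const_mul (hφ : IsConvex φ) {c : ℝ} (hc : 0 < c) :
    IsConvex fun x => (c : EReal) * φ x := by
  have mem_dom {x : H} (hx : (c : EReal) * φ x < ⊤) : x ∈ dom φ :=
    lt_top_iff_ne_top.2 fun h => hx.ne (h ▸ EReal.coe_mul_top_of_pos hc)
  have hc₀ : (0 : EReal) ≤ c := by exact_mod_cast hc.le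
  intro x hx y hy t ht₀ ht₁
  refine (mul_le_mul_of_nonneg_left (hφ x (mem_dom hx) y (mem_dom hy) t ht₀ ht₁) hc₀).trans_eq ?_
  rw [EReal.left_distrib_of_nonneg_of_ne_top hc₀ (EReal.coe_ne_top c), mul_left_comm,
    mul_left_comm (c : EReal)]

theorem IsConvex.iSup {ι : Sort*} {φ : ι → H → EReal} (hφ : ∀ i, IsConvex (φ i)) :
    IsConvex fun x => ⨆ i, φ i x := by
  intro x hx y hy t ht₀ ht₁
  refine iSup_le fun i => (hφ i x ((le_iSup (φ · x) i).trans_lt hx) y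
    ((le_iSup (φ · y) i).trans_lt hy) t ht₀ ht₁).trans (add_le_add ?_ ?_)
  · exact mul_le_mul_of_nonneg_left (le_iSup (φ · x) i) (by exact_mod_cast ht₀.le)
  · exact mul_le_mul_of_nonneg_left (le_iSup (φ · y) i) (by exact_mod_cast (sub_pos.2 ht₁).le)

theorem IsConvex.comp_linearMap {E : Type*} [AddCommGroup E] [Module ℝ E] (hφ : IsConvex φ)
    (T : E →ₗ[ℝ] H) : IsConvex fun x => φ (T x) := by
  intro x hx y hy t ht₀ ht₁
  simpa only [map_add, map_smul] using hφ (T x) hx (T y) hy t ht₀ ht₁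

theorem isConvex_coe {g : H → ℝ} (hg : ConvexOn ℝ Set.univ g) :
    IsConvex fun x => (g x : EReal) := by
  intro x _ y _ t ht₀ ht₁
  beta_reduce
  exact_mod_cast hg.2 (Set.mem_univ x) (Set.mem_univ y) ht₀.le (sub_pos.2 ht₁).le
    (add_sub_cancel t 1)

variable [TopologicalSpace H]

/-- A closed convex function with values in `(-∞, ∞]`, that is, an element of `Γ₀` or the constant
`∞`. Properness is left out because sums do not preserve it. -/
structure IsClosedConvex (φ : H → EReal) : Prop where
  ne_bot : ∀ x, φ x ≠ ⊥
  lsc : LowerSemicontinuous φ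
  convex : IsConvex φ

theorem IsClosedConvex.add (hφ : IsClosedConvex φ) (hψ : IsClosedConvex ψ) :
    IsClosedConvex fun x => φ x + ψ x where
  ne_bot x := by simp [EReal.add_eq_bot_iff, hφ.ne_bot, hψ.ne_bot]
  lsc := hφ.lsc.add' hψ.lsc fun x =>
    EReal.continuousAt_add (.inr (hψ.ne_bot x)) (.inl (hφ.ne_bot x))
  convex := hφ.convex.add hψ.convex hφ.ne_bot hψ.ne_bot

theorem continuous_coe_mul (c : ℝ) : Continuous fun s : EReal => c * s :=
  continuous_iff_continuousAt.2 fun _ =>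
    EReal.Tendsto.const_mul tendsto_id (.inl (EReal.coe_ne_bot c)) (.inl (EReal.coe_ne_top c))

theorem IsClosedConvex.const_mul (hφ : IsClosedConvex φ) {c : ℝ} (hc : 0 < c) :
    IsClosedConvex fun x => (c : EReal) * φ x where
  ne_bot x := by simp [EReal.mul_eq_bot, hφ.ne_bot, hc.not_gt]
  lsc :=
    (continuous_coe_mul c).comp_lowerSemicontinuous hφ.lsc
      fun _ _ h => mul_le_mul_of_nonneg_left h (by exact_mod_cast hc.le)
  convex := hφ.convex.const_mul hc

theorem IsClosedConvex.iSup {ι : Sort*} [Nonempty ι] {φ : ι → H → EReal}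
    (hφ : ∀ i, IsClosedConvex (φ i)) : IsClosedConvex fun x => ⨆ i, φ i x where
  ne_bot x := by
    obtain ⟨i⟩ := ‹Nonempty ι›
    exact ne_bot_of_le_ne_bot ((hφ i).ne_bot x) (le_iSup (φ · x) i)
  lsc := lowerSemicontinuous_iSup fun i => (hφ i).lsc
  convex := .iSup fun i => (hφ i).convex

theorem IsClosedConvex.comp_linearMap {E : Type*} [AddCommGroup E] [Module ℝ E]
    [TopologicalSpace E] (hφ : IsClosedConvex φ) {T : E →ₗ[ℝ] H} (hT : Continuous T) :
    IsClosedConvex fun x => φ (T x) where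
  ne_bot x := hφ.ne_bot (T x)
  lsc := hφ.lsc.comp hT
  convex := hφ.convex.comp_linearMap T

theorem isClosedConvex_coe {g : H → ℝ} (hg : ConvexOn ℝ Set.univ g) (hg' : Continuous g) :
    IsClosedConvex fun x => (g x : EReal) where
  ne_bot x := EReal.coe_ne_bot (g x)
  lsc := (continuous_coe_real_ereal.comp hg').lowerSemicontinuous
  convex := isConvex_coe hg

theorem IsGammaZero.isClosedConvex {H : Type*} [NormedAddCommGroup H] [InnerProductSpace ℝ H]
    {φ : H → EReal} (hφ : IsGammaZero φ) : IsClosedConvex φ :=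
  ⟨hφ.ne_bot, hφ.lsc, hφ.convex⟩

end ClosedConvex

section Recession

theorem mem_asymptoticCone_of_ray {E : Type*} [AddCommGroup E] [Module ℝ E] [TopologicalSpace E]
    [IsTopologicalAddGroup E] [ContinuousSMul ℝ E] {s : Set E} {x d : E}
    (h : ∀ t : ℝ, 0 ≤ t → x + t • d ∈ s) : d ∈ asymptoticCone ℝ s :=
  ((tendsto_id.atTop_smul_const_tendsto_asymptoticNhds d).const_vadd_asymptoticNhds x).frequently
    ((eventually_ge_atTop 0).mono h).frequently

theorem IsClosedConvex.eq_zero_of_ray_le {H : Type*} [AddCommGroup H] [Module ℝ H]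
    [TopologicalSpace H] [IsTopologicalAddGroup H] [ContinuousSMul ℝ H] {φ : H → EReal}
    (hφ : IsClosedConvex φ) (hc : IsCoercive φ) {x d : H} {c : ℝ}
    (h : ∀ t : ℝ, 0 ≤ t → φ (x + t • d) ≤ c) : d = 0 := by
  have hclosed : IsClosed {p : H × ℝ | φ p.1 ≤ p.2} :=
    hφ.lsc.isClosed_epigraph.preimage
      (continuous_fst.prodMk (continuous_coe_real_ereal.comp continuous_snd))
  have hcone : (d, (0 : ℝ)) ∈ asymptoticCone ℝ {p : H × ℝ | φ p.1 ≤ p.2} :=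
    mem_asymptoticCone_of_ray (x := (x, c)) fun t ht => by simpa using h t ht
  have hle (v : H) : φ (v + d) ≤ φ v := by
    refine EReal.le_of_forall_lt_iff_le.1 fun r hr => ?_
    have := hφ.convex.convex_epigraph.smul_vadd_mem_of_isClosed_of_mem_asymptoticCone hclosed
      zero_le_one hcone (p := (v, r)) hr.le
    simpa [add_comm] using this
  by_contra hd
  exact (hc d hd).not_ge (iSup₂_le fun v _ => EReal.sub_nonpos.2 (hle v))

theorem map_eq_zero_of_ray_le {X W : Type*} [AddCommGroup X] [Module ℝ X]
    [NormedAddCommGroup W] [InnerProductSpace ℝ W] {φ : X → EReal} {T : X →ₗ[ℝ] W} {α : ℝ}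
    (hα : 0 < α) (hφ : IsConvex fun x => φ x - ((α / 2 * ‖T x‖ ^ 2 : ℝ) : EReal))
    (hb : IsBoundedBelow φ) {x d : X} {c : ℝ} (h : ∀ t : ℝ, 0 ≤ t → φ (x + t • d) ≤ c) :
    T d = 0 := by
  obtain ⟨m, hm⟩ := hb
  have hbound (t : ℝ) (ht : 0 ≤ t) : t ^ 2 * (α / 2 * ‖T d‖ ^ 2) ≤ c - m := by
    have hmem {y : X} (hy : φ y ≤ c) : φ y - ((α / 2 * ‖T y‖ ^ 2 : ℝ) : EReal) ≤
        ((c - α / 2 * ‖T y‖ ^ 2 : ℝ) : EReal) := EReal.sub_le_sub hy le_rfl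
    have hx : φ x ≤ c := by simpa using h 0 le_rfl
    have hcenter : (1 / 2 : ℝ) • x + (1 / 2 : ℝ) • (x + (2 * t) • d) = x + t • d := by module
    have hmid := hφ.convex_epigraph (x := (x, _)) (hmem hx)
      (y := (x + (2 * t) • d, _)) (hmem (h (2 * t) (by positivity)))
      (a := 1 / 2) (b := 1 / 2) (by norm_num) (by norm_num) (by norm_num)
    simp only [Set.mem_ofPred_eq, Prod.smul_mk, Prod.mk_add_mk, hcenter] at hmid
    have hreal := (EReal.sub_le_sub (hm (x + t • d)) le_rfl).trans hmid
    norm_cast at hreal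
    have hadd : T (x + t • d) + t • T d = T (x + (2 * t) • d) := by
      simp only [map_add, map_smul]
      module
    have hsub : T (x + t • d) - t • T d = T x := by simp
    have hparallelogram := parallelogram_law_with_norm ℝ (T (x + t • d)) (t • T d)
    rw [hadd, hsub, norm_smul, Real.norm_of_nonneg ht] at hparallelogram
    simp only [smul_eq_mul] at hreal
    linear_combination hreal - α / 4 * hparallelogram
  by_contra hne
  have hpos : 0 < α / 2 * ‖T d‖ ^ 2 := by positivity
  obtain ⟨t, hlt, ht⟩ := (((tendsto_pow_atTop two_ne_zero).atTop_mul_const hpos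
    |>.eventually_gt_atTop (c - m)).and (eventually_ge_atTop 0)).exists
  exact (hbound t ht).not_gt hlt

end Recession

section Existence

variable {E : Type*} [NormedAddCommGroup E] [NormedSpace ℝ E] [FiniteDimensional ℝ E]

theorem isCompact_of_forall_ray {T : Set E} (hT : Convex ℝ T) (hclosed : IsClosed T)
    (hray : ∀ x d, (∀ t : ℝ, 0 ≤ t → x + t • d ∈ T) → d = 0) : IsCompact T := by
  rcases T.eq_empty_or_nonempty with rfl | ⟨x, hx⟩
  · exact isCompact_empty
  refine Metric.isCompact_of_isClosed_isBounded hclosed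
    (isBounded_iff_asymptoticCone_subset_singleton.2 fun d hd => hray x d fun t ht => ?_)
  rw [add_comm, ← vadd_eq_add]
  exact hT.smul_vadd_mem_of_isClosed_of_mem_asymptoticCone hclosed ht hd hx

theorem IsClosedConvex.exists_isMinOn {φ : E → EReal} {D : Set E}
    (hφ : IsClosedConvex φ) (hD : Convex ℝ D) (hDclosed : IsClosed D) (hDne : D.Nonempty)
    (hray : ∀ x d (c : ℝ), (∀ t : ℝ, 0 ≤ t → x + t • d ∈ D ∧ φ (x + t • d) ≤ c) → d = 0) :
    ∃ x ∈ D, IsMinOn φ D x := by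
  by_cases hfin : ∃ x₀ ∈ D, φ x₀ < ⊤
  · obtain ⟨x₀, hx₀, hlt⟩ := hfin
    obtain ⟨c, hc, -⟩ := EReal.lt_iff_exists_real_btwn.1 hlt
    have hcompact : IsCompact (D ∩ {x | φ x ≤ c}) :=
      isCompact_of_forall_ray (hD.inter (hφ.convex.convex_sublevel c))
        (hDclosed.inter (hφ.lsc.isClosed_preimage c)) fun x d => hray x d c
    obtain ⟨x, ⟨hxD, hxc⟩, hmin⟩ :=
      LowerSemicontinuousOn.exists_isMinOn (s := D ∩ {x | φ x ≤ c}) ⟨x₀, hx₀, hc.le⟩ hcompact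
        (hφ.lsc.lowerSemicontinuousOn _)
    refine ⟨x, hxD, fun y hy => ?_⟩
    rcases le_total (φ y) c with h | h
    · exact hmin ⟨hy, h⟩
    · exact le_trans hxc h
  · push Not at hfin
    obtain ⟨x, hx⟩ := hDne
    exact ⟨x, hx, fun y hy => le_top.trans (hfin y hy)⟩

variable {H : Type*} [NormedAddCommGroup H] [InnerProductSpace ℝ H] [FiniteDimensional ℝ H]

theorem image_add_inter_orthogonal {α : Type*} {g : H → α} (N : Submodule ℝ H)
    (hg : ∀ x, ∀ n ∈ N, g (x + n) = g x) (D : Set H) :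
    g '' ((D + (N : Set H)) ∩ (Nᗮ : Set H)) = g '' D := by
  apply subset_antisymm
  · rintro _ ⟨_, ⟨⟨x, hx, n, hn, rfl⟩, -⟩, rfl⟩
    exact ⟨x, hx, (hg x n hn).symm⟩
  · rintro _ ⟨x, hx, rfl⟩
    obtain ⟨n, hn, p, hp, rfl⟩ := N.exists_add_mem_mem_orthogonal x
    exact ⟨p, ⟨⟨n + p, hx, -n, N.neg_mem hn, by simp⟩, hp⟩, by rw [add_comm, hg p n hn]⟩

theorem IsClosedConvex.exists_isMinOn_of_invariant {φ : H → EReal} {D : Set H}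
    (hφ : IsClosedConvex φ) (N : Submodule ℝ H) (hN : ∀ x, ∀ n ∈ N, φ (x + n) = φ x)
    (hD : Convex ℝ D) (hDN : IsClosed (D + (N : Set H))) (hDne : D.Nonempty)
    (hray : ∀ x d (c : ℝ), (∀ t : ℝ, 0 ≤ t → φ (x + t • d) ≤ c) → d ∈ N) :
    ∃ x ∈ D, IsMinOn φ D x := by
  have himage := image_add_inter_orthogonal N hN D
  obtain ⟨p, hp, hmin⟩ := hφ.exists_isMinOn (D := (D + (N : Set H)) ∩ (Nᗮ : Set H))
    ((hD.add N.convex).inter Nᗮ.convex) (hDN.inter Nᗮ.closed_of_finiteDimensional)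
    (Set.image_nonempty.1 (himage ▸ hDne.image φ)) fun x d c h => by
      refine Submodule.disjoint_def.1 N.orthogonal_disjoint d (hray x d c fun t ht => (h t ht).2) ?_
      simpa using Nᗮ.sub_mem (h 1 zero_le_one).1.2 (h 0 le_rfl).1.2
  obtain ⟨x, hx, hxp⟩ : φ p ∈ φ '' D := himage ▸ Set.mem_image_of_mem φ hp
  refine ⟨x, hx, fun y hy => ?_⟩
  obtain ⟨q, hq, hqy⟩ := himage.ge (Set.mem_image_of_mem φ hy)
  exact hxp.trans_le ((hmin hq).trans_eq hqy)

theorem IsCoercive.isBoundedBelow_comp {Y : Type*} [AddCommGroup Y] [Module ℝ Y]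
    [TopologicalSpace Y] [IsTopologicalAddGroup Y] [ContinuousSMul ℝ Y]
    {f : Y → EReal} (hc : IsCoercive f) (hf : IsClosedConvex f) (A : H →ₗ[ℝ] Y) :
    IsBoundedBelow fun x => f (A x) := by
  obtain ⟨x, -, hmin⟩ :=
    (hf.comp_linearMap A.continuous_of_finiteDimensional).exists_isMinOn_of_invariant A.ker
      (fun x n hn => by rw [map_add, LinearMap.mem_ker.1 hn, add_zero]) convex_univ
      (by simp) Set.univ_nonempty fun x d c h =>
        hf.eq_zero_of_ray_le hc fun t ht => by simpa using h t ht
  obtain ⟨m, -, hm⟩ := EReal.lt_iff_exists_real_btwn.1 (bot_lt_iff_ne_bot.2 (hf.ne_bot (A x)))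
  exact ⟨m, fun y => hm.le.trans (hmin (Set.mem_univ y))⟩

end Existence

section Cost

variable {X Y Z W : Type*} [NormedAddCommGroup X] [InnerProductSpace ℝ X]
  [NormedAddCommGroup Y] [InnerProductSpace ℝ Y] [NormedAddCommGroup Z] [InnerProductSpace ℝ Z]
  [NormedAddCommGroup W] [InnerProductSpace ℝ W]
  {f : Y → EReal} {A : X →ₗ[ℝ] Y} {μ : ℝ} {Ψ : Z → EReal} {B : Z →ₗ[ℝ] W} {L : X →ₗ[ℝ] Z}

theorem gme_eq_iSup (hΨ : IsGammaZero Ψ) (B : Z →ₗ[ℝ] W) (z : Z) :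
    gme Ψ B z = ⨆ v : dom Ψ, (Ψ z - (Ψ v + ((1 / 2 * ‖B (z - v)‖ ^ 2 : ℝ) : EReal))) := by
  let u (v : Z) : EReal := Ψ v + ((1 / 2 * ‖B (z - v)‖ ^ 2 : ℝ) : EReal)
  obtain ⟨v₀, hv₀⟩ := hΨ.proper
  have : Nonempty (dom Ψ) := ⟨v₀, hv₀⟩
  have hu : ⨅ v, u v = ⨅ v : dom Ψ, u v := by
    refine le_antisymm (le_iInf fun v => iInf_le u v) (le_iInf fun v => ?_)
    by_cases hv : Ψ v < ⊤
    · exact iInf_le (fun w : dom Ψ => u w) ⟨v, hv⟩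
    · simp only [u, top_le_iff.1 (not_lt.1 hv), EReal.top_add_coe, le_top]
  have hlt : ⨅ v : dom Ψ, u v < ⊤ :=
    (iInf_le _ ⟨v₀, hv₀⟩).trans_lt (EReal.add_lt_top hv₀.ne (EReal.coe_ne_top _))
  have hcont : ContinuousAt (fun s => Ψ z - s) (⨅ v : dom Ψ, u v) :=
    ContinuousAt.comp (f := fun s => (Ψ z, -s))
      (EReal.continuousAt_add (.inr (EReal.neg_eq_bot_iff.not.2 hlt.ne)) (.inl (hΨ.ne_bot z)))
      (continuousAt_const.prodMk continuous_neg.continuousAt)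
  have hanti : Antitone fun s => Ψ z - s := fun s t hst => EReal.sub_le_sub le_rfl hst
  exact (congrArg (Ψ z - ·) hu).trans (hanti.map_ciInf_of_continuousAt hcont)

theorem gme_nonneg (hΨ : IsGammaZero Ψ) (B : Z →ₗ[ℝ] W) (z : Z) : 0 ≤ gme Ψ B z := by
  rw [gme_eq_iSup hΨ]
  by_cases hz : Ψ z < ⊤
  · refine le_iSup_of_le ⟨z, hz⟩ ?_
    simp [EReal.sub_self hz.ne (hΨ.ne_bot z)]
  · obtain ⟨v, hv⟩ := hΨ.proper
    refine le_iSup_of_le ⟨v, hv⟩ ?_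
    rw [top_le_iff.1 (not_lt.1 hz), EReal.top_sub (EReal.add_ne_top hv.ne (EReal.coe_ne_top _))]
    exact le_top

theorem comp_le_cost (hΨ : IsGammaZero Ψ) (hμ : 0 < μ) (x : X) :
    f (A x) ≤ cost f A μ Ψ B L x :=
  le_add_of_nonneg_right (mul_nonneg (by exact_mod_cast hμ.le) (gme_nonneg hΨ B (L x)))

/-- The value at `x` of the cost function with `v` in place of the minimiser in `gme`, the squares
being expanded so that joint convexity shows: the first summand is convex by `OverallConvexity`,
the last one is affine in `x`. -/
noncomputable def costMinorant (f : Y → EReal) (A : X →ₗ[ℝ] Y) (μ : ℝ) (Ψ : Z → EReal)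
    (B : Z →ₗ[ℝ] W) (L : X →ₗ[ℝ] Z) (v : Z) (x : X) : EReal :=
  (f (A x) - ((μ / 2 * ‖B (L x)‖ ^ 2 : ℝ) : EReal)) + μ * Ψ (L x) +
    ((μ * (inner ℝ (B v) (B (L x)) - 1 / 2 * ‖B v‖ ^ 2 - (Ψ v).toReal) : ℝ) : EReal)

theorem costMinorant_eq (hμ : 0 < μ) {v : Z} (hv : v ∈ dom Ψ) (hv_bot : Ψ v ≠ ⊥) (x : X) :
    costMinorant f A μ Ψ B L v x =
      f (A x) + μ * (Ψ (L x) - (Ψ v + ((1 / 2 * ‖B (L x - v)‖ ^ 2 : ℝ) : EReal))) := by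
  have hcomplete : -(μ / 2 * ‖B (L x)‖ ^ 2) +
      μ * (inner ℝ (B v) (B (L x)) - 1 / 2 * ‖B v‖ ^ 2 - (Ψ v).toReal) =
      μ * -((Ψ v).toReal + 1 / 2 * ‖B (L x - v)‖ ^ 2) := by
    rw [map_sub, norm_sub_sq_real, real_inner_comm]
    ring
  conv_rhs => rw [← EReal.coe_toReal hv.ne hv_bot, ← EReal.coe_add, sub_eq_add_neg,
    ← EReal.coe_neg, EReal.left_distrib_of_nonneg_of_ne_top (by exact_mod_cast hμ.le)
      (EReal.coe_ne_top μ), ← EReal.coe_mul, ← hcomplete, EReal.coe_add]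
  rw [costMinorant, sub_eq_add_neg, ← EReal.coe_neg]
  abel

theorem cost_eq_iSup (hf_bot : ∀ y, f y ≠ ⊥) (hΨ : IsGammaZero Ψ) (hμ : 0 < μ) :
    cost f A μ Ψ B L = fun x => ⨆ v : dom Ψ, costMinorant f A μ Ψ B L v x := by
  funext x
  have : Nonempty (dom Ψ) := hΨ.proper.to_subtype
  have hμ₀ : (0 : EReal) ≤ μ := by exact_mod_cast hμ.le
  have hmono : Monotone fun s => f (A x) + μ * s := fun s t hst =>
    add_le_add_right (mul_le_mul_of_nonneg_left hst hμ₀) _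
  have hne_bot : (μ : EReal) * gme Ψ B (L x) ≠ ⊥ :=
    ne_bot_of_le_ne_bot EReal.zero_ne_bot (mul_nonneg hμ₀ (gme_nonneg hΨ B (L x)))
  have hcont : ContinuousAt (fun s => f (A x) + μ * s) (gme Ψ B (L x)) :=
    ContinuousAt.comp (f := fun s : EReal => (f (A x), μ * s))
      (EReal.continuousAt_add (.inr hne_bot) (.inl (hf_bot (A x))))
      (continuousAt_const.prodMk (continuous_coe_mul μ).continuousAt)
  simp only [costMinorant_eq hμ (Subtype.prop _) (hΨ.ne_bot _)]
  rw [gme_eq_iSup hΨ] at hcont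
  rw [cost, gme_eq_iSup hΨ, hmono.map_ciSup_of_continuousAt hcont]

theorem isClosedConvex_cost [FiniteDimensional ℝ X] (hf : IsClosedConvex f) (hΨ : IsGammaZero Ψ)
    (hμ : 0 < μ)
    (hC1 : IsConvex fun x => f (A x) - ((μ / 2 * ‖B (L x)‖ ^ 2 : ℝ) : EReal)) :
    IsClosedConvex (cost f A μ Ψ B L) := by
  have : Nonempty (dom Ψ) := hΨ.proper.to_subtype
  have hA : Continuous A := A.continuous_of_finiteDimensional
  have hL : Continuous L := L.continuous_of_finiteDimensional
  have hBL : Continuous fun x => B (L x) := (B ∘ₗ L).continuous_of_finiteDimensional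
  have hfirst : IsClosedConvex fun x => f (A x) - ((μ / 2 * ‖B (L x)‖ ^ 2 : ℝ) : EReal) := by
    refine ⟨fun x => ?_, ?_, hC1⟩
    · simp only [sub_eq_add_neg, ← EReal.coe_neg, ne_eq, EReal.add_eq_bot_iff, hf.ne_bot,
        EReal.coe_ne_bot, or_self, not_false_eq_true]
    · simp only [sub_eq_add_neg, ← EReal.coe_neg]
      refine (hf.lsc.comp hA).add' ?_ fun x =>
        EReal.continuousAt_add (.inr (EReal.coe_ne_bot _)) (.inr (EReal.coe_ne_top _))
      exact (continuous_coe_real_ereal.comp ((hBL.norm.pow 2).const_mul _).neg).lowerSemicontinuous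
  have hlast (v : Z) : ConvexOn ℝ Set.univ fun x =>
      μ * (inner ℝ (B v) (B (L x)) - 1 / 2 * ‖B v‖ ^ 2 - (Ψ v).toReal) := by
    refine ⟨convex_univ, fun x _ y _ a b _ _ hab => le_of_eq ?_⟩
    simp only [map_add, map_smul, inner_add_right, inner_smul_right, smul_eq_mul]
    linear_combination (μ * (1 / 2 * ‖B v‖ ^ 2 + (Ψ v).toReal)) * hab
  rw [cost_eq_iSup hf.ne_bot hΨ hμ]
  exact .iSup fun v => (hfirst.add ((hΨ.isClosedConvex.const_mul hμ).comp_linearMap hL)).add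
    (isClosedConvex_coe (hlast v)
      ((((continuous_const.inner hBL).sub continuous_const).sub continuous_const).const_mul μ))

theorem le_of_cost_le (hΨ : IsGammaZero Ψ) (hμ : 0 < μ) {m c : ℝ} {x : X} (hm : m ≤ f (A x))
    (hc : cost f A μ Ψ B L x ≤ c) {v : Z} (hv : v ∈ dom Ψ) :
    Ψ (L x) ≤ (((c - m) / μ + ((Ψ v).toReal + 1 / 2 * ‖B (L x - v)‖ ^ 2) : ℝ) : EReal) := by
  have hle : Ψ (L x) - (((Ψ v).toReal + 1 / 2 * ‖B (L x - v)‖ ^ 2 : ℝ) : EReal) ≤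
      gme Ψ B (L x) := by
    rw [gme_eq_iSup hΨ, EReal.coe_add, EReal.coe_toReal hv.ne (hΨ.ne_bot v)]
    exact le_iSup_of_le ⟨v, hv⟩ le_rfl
  have hgme : gme Ψ B (L x) ≤ (((c - m) / μ : ℝ) : EReal) := by
    rw [EReal.coe_div, EReal.le_div_iff_mul_le (by exact_mod_cast hμ) (EReal.coe_ne_top μ),
      mul_comm, EReal.coe_sub, EReal.le_sub_iff_add_le (.inl (EReal.coe_ne_bot m))
        (.inl (EReal.coe_ne_top m)), add_comm]
    exact (add_le_add_left hm _).trans hc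
  rw [EReal.coe_add]
  exact (EReal.sub_le_iff_le_add (.inl (EReal.coe_ne_bot _)) (.inl (EReal.coe_ne_top _))).1
    (hle.trans hgme)

theorem map_eq_zero_of_cost_ray_le (hΨ : IsGammaZero Ψ) (hΨc : IsCoercive Ψ) (hμ : 0 < μ)
    (hC1 : IsConvex fun x => f (A x) - ((μ / 2 * ‖B (L x)‖ ^ 2 : ℝ) : EReal))
    (hf : IsBoundedBelow fun x => f (A x)) {x d : X} {c : ℝ}
    (h : ∀ t : ℝ, 0 ≤ t → cost f A μ Ψ B L (x + t • d) ≤ c) : L d = 0 := by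
  have hBLd : B (L d) = 0 :=
    map_eq_zero_of_ray_le (T := B ∘ₗ L) hμ hC1 hf fun t ht => (comp_le_cost hΨ hμ _).trans (h t ht)
  obtain ⟨m, hm⟩ := hf
  obtain ⟨v, hv⟩ := hΨ.proper
  refine hΨ.isClosedConvex.eq_zero_of_ray_le hΨc (x := L x)
    (c := (c - m) / μ + ((Ψ v).toReal + 1 / 2 * ‖B (L x - v)‖ ^ 2)) fun t ht => ?_
  have hle := le_of_cost_le hΨ hμ (hm _) (h t ht) hv
  rwa [map_sub, map_add L, map_add B, map_smul, map_smul, hBLd, smul_zero, add_zero, ← map_sub]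
    at hle

variable [FiniteDimensional ℝ X] {D : Set X}

theorem exists_isMinOn_cost_of_isCoercive (hf : IsClosedConvex f) (hfc : IsCoercive f)
    (hΨ : IsGammaZero Ψ) (hΨc : IsCoercive Ψ) (hμ : 0 < μ)
    (hC1 : IsConvex fun x => f (A x) - ((μ / 2 * ‖B (L x)‖ ^ 2 : ℝ) : EReal))
    (hD : Convex ℝ D) (hDne : D.Nonempty)
    (hDclosed : IsClosed (D + ((A.ker ⊓ L.ker : Submodule ℝ X) : Set X))) :
    ∃ x ∈ D, IsMinOn (cost f A μ Ψ B L) D x := by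
  refine (isClosedConvex_cost hf hΨ hμ hC1).exists_isMinOn_of_invariant (A.ker ⊓ L.ker) ?_ hD
    hDclosed hDne fun x d c h => ⟨?_, ?_⟩
  · rintro x n ⟨hA, hL⟩
    rw [cost, map_add, map_add, LinearMap.mem_ker.1 hA, LinearMap.mem_ker.1 hL, add_zero,
      add_zero, cost]
  · exact hf.eq_zero_of_ray_le hfc (x := A x) fun t ht => by
      simpa using (comp_le_cost hΨ hμ _).trans (h t ht)
  · exact map_eq_zero_of_cost_ray_le hΨ hΨc hμ hC1 (hfc.isBoundedBelow_comp hf A) h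

theorem exists_isMinOn_cost_of_injective (hf : IsClosedConvex f)
    (hfb : IsBoundedBelow fun x => f (A x)) (hΨ : IsGammaZero Ψ) (hΨc : IsCoercive Ψ) (hμ : 0 < μ)
    (hC1 : IsConvex fun x => f (A x) - ((μ / 2 * ‖B (L x)‖ ^ 2 : ℝ) : EReal))
    (hL : Function.Injective L) (hD : Convex ℝ D) (hDclosed : IsClosed D) (hDne : D.Nonempty) :
    ∃ x ∈ D, IsMinOn (cost f A μ Ψ B L) D x :=
  (isClosedConvex_cost hf hΨ hμ hC1).exists_isMinOn hD hDclosed hDne fun _ _ _ h =>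
    (map_eq_zero_iff L hL).1
      (map_eq_zero_of_cost_ray_le hΨ hΨc hμ hC1 hfb fun t ht => (h t ht).2)

theorem overallConvexity_iff [FiniteDimensional ℝ Z] [FiniteDimensional ℝ W] :
    OverallConvexity f A μ B L ↔
      IsConvex fun x => f (A x) - ((μ / 2 * ‖B (L x)‖ ^ 2 : ℝ) : EReal) := by
  have hquad (x : X) : μ * quad (LinearMap.adjoint L ∘ₗ LinearMap.adjoint B ∘ₗ B ∘ₗ L) x =
      μ / 2 * ‖B (L x)‖ ^ 2 := by
    simp only [quad, LinearMap.comp_apply, LinearMap.adjoint_inner_left,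
      real_inner_self_eq_norm_sq]
    ring
  simp only [OverallConvexity, IsStronglyConvexRel, hquad]

end Cost

end CLiGME

theorem theorem3p3_general
    {X Y Z W : Type*}
    [NormedAddCommGroup X] [InnerProductSpace ℝ X] [FiniteDimensional ℝ X]
    [NormedAddCommGroup Y] [InnerProductSpace ℝ Y]
    [NormedAddCommGroup Z] [InnerProductSpace ℝ Z]
    [NormedAddCommGroup W] [InnerProductSpace ℝ W]
    {A : X →ₗ[ℝ] Y} {f : Y → EReal} (hf : CLiGME.IsClosedConvex f)
    {Ψ : Z → EReal} (hΨ : CLiGME.IsGammaZero Ψ) (hΨc : CLiGME.IsCoercive Ψ)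
    {μ : ℝ} (hμ : 0 < μ) {L : X →ₗ[ℝ] Z} {B : Z →ₗ[ℝ] W}
    {D : Set X} (hDclosed : IsClosed D) (hD : Convex ℝ D) (hDne : D.Nonempty)
    (hC1 : CLiGME.IsConvex fun x => f (A x) - ((μ / 2 * ‖B (L x)‖ ^ 2 : ℝ) : EReal))
    (hcond :
      (CLiGME.IsCoercive f ∧ CLiGME.IsAsymptoticallyMultipolyhedral D) ∨
      (CLiGME.IsCoercive f ∧ LinearMap.ker A ⊓ LinearMap.ker L = ⊥) ∨
      (CLiGME.IsBoundedBelow f ∧ LinearMap.ker L = ⊥) ∨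
      Bornology.IsBounded D) :
    ∃ x ∈ D, IsMinOn (CLiGME.cost f A μ Ψ B L) D x := by
  rcases hcond with ⟨hfc, hDpoly⟩ | ⟨hfc, hker⟩ | ⟨⟨m, hm⟩, hL⟩ | hDbdd
  · exact CLiGME.exists_isMinOn_cost_of_isCoercive hf hfc hΨ hΨc hμ hC1 hD hDne
      (hDpoly.isClosed_add_submodule _)
  · exact CLiGME.exists_isMinOn_cost_of_isCoercive hf hfc hΨ hΨc hμ hC1 hD hDne
      (by simpa [hker] using hDclosed)
  · exact CLiGME.exists_isMinOn_cost_of_injective hf ⟨m, fun x => hm (A x)⟩ hΨ hΨc hμ hC1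
      (LinearMap.ker_eq_bot.1 hL) hD hDclosed hDne
  · exact LowerSemicontinuousOn.exists_isMinOn hDne
      (Metric.isCompact_of_isClosed_isBounded hDclosed hDbdd)
      ((CLiGME.isClosedConvex_cost hf hΨ hμ hC1).lsc.lowerSemicontinuousOn D)

theorem theorem3p3
    {X Y Z W V : Type*}
    [NormedAddCommGroup X] [InnerProductSpace ℝ X] [FiniteDimensional ℝ X]
    [NormedAddCommGroup Y] [InnerProductSpace ℝ Y] [FiniteDimensional ℝ Y]
    [NormedAddCommGroup Z] [InnerProductSpace ℝ Z] [FiniteDimensional ℝ Z]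
    [NormedAddCommGroup W] [InnerProductSpace ℝ W] [FiniteDimensional ℝ W]
    [NormedAddCommGroup V] [InnerProductSpace ℝ V] [FiniteDimensional ℝ V]
    (A : X →ₗ[ℝ] Y) (f : Y → EReal)
    (hf : CLiGME.IsGammaZero f) (hfdom : CLiGME.dom f = Set.univ)
    (Ψ : Z → EReal) (hΨ : CLiGME.IsGammaZero Ψ) (hΨc : CLiGME.IsCoercive Ψ)
    (μ : ℝ) (hμ : 0 < μ) (L : X →ₗ[ℝ] Z) (B : Z →ₗ[ℝ] W)
    (Δ : Set V) (hΔclosed : IsClosed Δ) (hΔconvex : Convex ℝ Δ) (C : X →ₗ[ℝ] V)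
    (hfeas : (CLiGME.dom (fun x => Ψ (L x)) ∩ C ⁻¹' Δ).Nonempty)
    (hC1 : CLiGME.OverallConvexity f A μ B L)
    (hcond :
      (CLiGME.IsCoercive f ∧ CLiGME.IsAsymptoticallyMultipolyhedral (C ⁻¹' Δ)) ∨
      (CLiGME.IsCoercive f ∧ LinearMap.ker A ⊓ LinearMap.ker L = ⊥) ∨
      (CLiGME.IsBoundedBelow f ∧ LinearMap.ker L = ⊥) ∨
      Bornology.IsBounded (C ⁻¹' Δ)) :
    ∃ x ∈ C ⁻¹' Δ, IsMinOn (CLiGME.cost f A μ Ψ B L) (C ⁻¹' Δ) x :=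
  theorem3p3_general hf.isClosedConvex hΨ hΨc hμ
    (hΔclosed.preimage C.continuous_of_finiteDimensional) (hΔconvex.linear_preimage C)
    (hfeas.mono Set.inter_subset_right) (CLiGME.overallConvexity_iff.1 hC1) hcond
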